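/- **Setting.** Let $\mathbb G=(\mathbb R^n,\circ,\delta_t)$ be a stratified group (homogeneous Carnot group): a smooth Lie group structure on $\mathbb R^n$ with identity $0$ whose coordinates carry integer weights $w_j\ge 1$ ($w_j=l$ if $x_j$ is a coordinate of the $l$-th stratum), such that every dilation $\delta_t(x)=(t^{w_1}x_1,\dots,t^{w_n}x_n)$, $t>0$, is a group automorphism and the left-invariant vector fields $X_1,\dots,X_N$ that coincide at $0$ with the $\partial_j$, $w_j=1$, generate a Lie algebra of vector fields of rank $n$ at every point. Write $X_i(x)\in\mathbb R^n$ for the coefficient vector of $X_i$ at $x$, $\nabla_{\mathbb G}u=(X_1u,\dots,X_Nu)$, and let $\langle\cdot,\cdot\rangle$, $\mathrm{dist}$ and $dx$ be the Euclidean inner product, the Euclidean distance and Lebesgue measure. Let $\Omega\subset\mathbb R^n$, $\Omega\neq\mathbb R^n$, be open and convex in the Euclidean sense. For $x\in\Omega$ let $\nu(x)$ be the inward unit normal of $\partial\Omega$ at a point $\hat x\in\partial\Omega$ nearest to $x$, that is, $|x-\hat x|=\mathrm{dist}(x,\partial\Omega)$, $|\nu(x)|=1$ and $\langle y-\hat x,\nu(x)\rangle\ge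 0$ for all $y\in\Omega$ (if there are several nearest points, any choice is allowed). Put $$\mathcal W(x)=\Big(\sum_{i=1}^N\langle X_i(x),\nu(x)\rangle^2\Big)^{1/2},$$ and let $X_i\langle X_i(x),\nu\rangle$ denote the derivative along $X_i$ of $y\mapsto\langle X_i(y),\nu\rangle$ at $y=x$, with the vector $\nu=\nu(x)$ held fixed. **Theorem 3.1.** For every $\beta<0$ and every real- or complex-valued $u\in C_0^\infty(\Omega)$ the functions in the three integrals below are integrable on $\Omega$, and $$\int_\Omega|\nabla_{\mathbb G}u|^2\,dx\ \ge\ -(\beta^2+\beta)\int_\Omega\frac{\mathcal W(x)^2}{\mathrm{dist}(x,\partial\Omega)^2}\,|u|^2\,dx+\beta\int_\Omega\sum_{i=1}^N\frac{X_i\langle X_i(x),\nu\rangle}{\mathrm{dist}(x,\partial\Omega)}\,|u|^2\,dx .$$ -/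

import Mathlib

open MeasureTheory
open scoped ContDiff

noncomputable section

/-- The space `ℝⁿ` with its Euclidean inner product, Euclidean distance and Lebesgue measure. -/
abbrev RSpace (n : ℕ) : Type := EuclideanSpace ℝ (Fin n)

/-- The dilation `δ_t x = (t ^ w₁ x₁, …, t ^ wₙ xₙ)` with weights `w`. -/
def anisotropicDilation {n : ℕ} (w : Fin n → ℕ) (t : ℝ) (x : RSpace n) : RSpace n :=
  WithLp.toLp 2 fun j => t ^ w j * x j

/-- The `j`-th member of the Jacobian basis of a group law `mul` on `ℝⁿ` with identity `0`: the
left-invariant vector field `x ↦ d(τ_x)(0) e_j`, `τ_x y = mul x y`, which equals `∂_j` at `0`. -/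
def jacobianField {n : ℕ} (mul : RSpace n → RSpace n → RSpace n) (j : Fin n) :
    RSpace n → RSpace n :=
  fun x => fderiv ℝ (fun y => mul x y) 0 (EuclideanSpace.single j 1)

/-- The iterated Lie brackets (commutators) of a set `S` of vector fields on `ℝⁿ`. Their linear
span is the Lie algebra generated by `S`. -/
inductive IteratedBracket {n : ℕ} (S : Set (RSpace n → RSpace n)) :
    (RSpace n → RSpace n) → Prop
  | basic (V : RSpace n → RSpace n) (hV : V ∈ S) : IteratedBracket S V
  | bracket (V W : RSpace n → RSpace n) (hV : IteratedBracket S V) (hW : IteratedBracket S W) :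
      IteratedBracket S (VectorField.lieBracket ℝ V W)

/-- A stratified group (homogeneous Carnot group) `𝔾 = (ℝⁿ, ∘, δ_t)`: a Lie group structure on
`ℝⁿ` with identity `0`, together with weights `w_j ≥ 1` (`w_j = l` if the `j`-th coordinate
belongs to the `l`-th stratum) such that every dilation `δ_t`, `t > 0`, is a group automorphism
and the members of the Jacobian basis belonging to the first stratum generate a Lie algebra of
vector fields of full rank `n` at each point. -/
structure StratifiedGroup (n : ℕ) extends Group (RSpace n) where
  one_eq_zero : one = 0
  contDiff_mul : ContDiff ℝ ∞ fun p : RSpace n × RSpace n => mul p.1 p.2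
  contDiff_inv : ContDiff ℝ ∞ inv
  weight : Fin n → ℕ
  one_le_weight : ∀ j, 1 ≤ weight j
  dilation_mul : ∀ t : ℝ, 0 < t → ∀ x y : RSpace n,
    anisotropicDilation weight t (mul x y) =
      mul (anisotropicDilation weight t x) (anisotropicDilation weight t y)
  span_brackets : ∀ x : RSpace n,
    Submodule.span ℝ
      {v | ∃ V, IteratedBracket {X | ∃ j, weight j = 1 ∧ X = jacobianField mul j} V ∧ V x = v} = ⊤

namespace StratifiedGroup

variable {n : ℕ} (G : StratifiedGroup n)

/-- The indices of the coordinates of the first stratum. -/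
abbrev FirstStratum : Type := {j : Fin n // G.weight j = 1}

/-- The Jacobian generators `X_i`, with `i` running over the first stratum; `G.X i x` is the
coefficient vector `X_i(x)` of the vector field at `x`. -/
def X (i : G.FirstStratum) : RSpace n → RSpace n :=
  jacobianField G.mul i.1

/-- The derivative `(X_i f)(x)` of a function `f` along `X_i`. -/
def XDeriv {F : Type*} [NormedAddCommGroup F] [NormedSpace ℝ F] (i : G.FirstStratum)
    (f : RSpace n → F) (x : RSpace n) : F :=
  fderiv ℝ f x (G.X i x)

/-- The horizontal gradient `∇_𝔾 u = (X_1 u, …, X_N u)`. -/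
def horizontalGradient {𝕜 : Type*} [RCLike 𝕜] (u : RSpace n → 𝕜) (x : RSpace n) :
    EuclideanSpace 𝕜 G.FirstStratum :=
  WithLp.toLp 2 fun i => G.XDeriv i u x

/-- The angle function `𝒲(x) = (∑ i, ⟨X_i(x), ν⟩ ^ 2) ^ (1 / 2)` at `x` for the unit vector `ν`. -/
def angleFunction (ν x : RSpace n) : ℝ :=
  Real.sqrt (∑ i, (inner ℝ (G.X i x) ν) ^ 2)

end StratifiedGroup

/-- `v` is an inward unit normal at the boundary point `p` of the convex set `Ω`: a unit vector
orthogonal to a supporting hyperplane of `Ω` at `p` and pointing to the side of `Ω`. -/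
def IsInwardUnitNormal {n : ℕ} (Ω : Set (RSpace n)) (p v : RSpace n) : Prop :=
  ‖v‖ = 1 ∧ ∀ y ∈ Ω, 0 ≤ inner ℝ (y - p) v

/-- `ν` assigns to each `x ∈ Ω` an inward unit normal of `∂Ω` at a point of `∂Ω` nearest to `x`. -/
def IsNearestNormalMap {n : ℕ} (Ω : Set (RSpace n)) (ν : RSpace n → RSpace n) : Prop :=
  ∀ x ∈ Ω, ∃ p ∈ frontier Ω,
    dist x p = Metric.infDist x (frontier Ω) ∧ IsInwardUnitNormal Ω p (ν x)

end

/-! Suppose first that `φ` is smooth, concave and positive on `Ω`. The fields `X_i` are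
divergence-free, because homogeneity makes the `k`-th coefficient independent of `x_k`. Hence `X_i
(f_i |u|²)` integrates to zero for `f_i = -β X_i φ / φ`. Completing the square gives `X_i (f_i |u|²)
≤ |X_i u|² + (X_i f_i + f_i²) |u|²`. Expanding `X_i f_i + f_i²` produces the two Hardy weights, with
`∇φ` in the role of `ν`, and a Hessian term that may be dropped since `β < 0` and `φ` is concave
(`integral_hardyWeight_le_of_contDiff`).

The boundary distance is not smooth, so it is approximated. On `Ω` it is the infimum of affine
functions with gradients `ν(x)`; that infimum defines a concave 1-Lipschitz `D` on the whole space
(`exists_concave_extension`). Mollifying `D` and shifting upwards yields smooth concave `φ_k ≥ D`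
converging to `D`. By Rademacher `D` is differentiable almost everywhere, on `Ω` its gradient there
must be `ν(x)`, and concavity forces `∇φ_k → ν` at such points. Dominated convergence on the support
of `u` (`tendsto_integral_weight`) then passes the inequality to the limit. -/

open Metric Set Filter Topology

/-! ### Supporting hyperplanes and the concave extension of the boundary distance. -/

section ConcaveExtension

variable {n : ℕ} {Ω : Set (RSpace n)}

/-- A point at nonnegative height above a supporting hyperplane of an open set has positive
height. -/
lemma IsInwardUnitNormal.inner_pos {p v : RSpace n} (hv : IsInwardUnitNormal Ω p v)
    (hΩ : IsOpen Ω) {y : RSpace n} (hy : y ∈ Ω) : 0 < inner ℝ (y - p) v := by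
  obtain ⟨ε, hε, hball⟩ := Metric.isOpen_iff.1 hΩ y hy
  -- Moving down by `ε / 2` stays in `Ω`, where the height is still nonnegative; so `y` has height
  -- at least `ε / 2`.
  have hmem : y - (ε / 2) • v ∈ Ω := by
    apply hball
    rw [mem_ball, dist_eq_norm, sub_sub_cancel_left, norm_neg, norm_smul, hv.1, mul_one,
      Real.norm_of_nonneg (by positivity)]
    linarith
  have h := hv.2 _ hmem
  rw [sub_right_comm, inner_sub_left, inner_smul_left, real_inner_self_eq_norm_sq, hv.1] at h
  simp only [conj_trivial, one_pow, mul_one] at h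
  linarith

/-- The distance to the boundary is at most the distance to a supporting hyperplane. -/
lemma IsInwardUnitNormal.infDist_frontier_le {p v : RSpace n} (hv : IsInwardUnitNormal Ω p v)
    (hΩ : IsOpen Ω) {y : RSpace n} (hy : y ∈ Ω) :
    infDist y (frontier Ω) ≤ inner ℝ (y - p) v := by
  set s : ℝ := inner ℝ (y - p) v with hs
  have hs0 : 0 < s := hv.inner_pos hΩ hy
  set z := y - s • v with hz
  have hzΩ : z ∉ Ω := by
    intro h
    have := hv.inner_pos hΩ h
    rw [hz, sub_right_comm, inner_sub_left, inner_smul_left, real_inner_self_eq_norm_sq, hv.1,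
      ← hs] at this
    simp at this
  -- The segment from `y` to its foot `z` on the hyperplane leaves `Ω`, so by connectedness it meets
  -- the boundary, at distance at most `s` from `y`.
  have hseg : (segment ℝ y z ∩ frontier Ω).Nonempty := by
    by_contra hemp
    rw [not_nonempty_iff_eq_empty, ← disjoint_iff_inter_eq_empty, disjoint_left] at hemp
    have hcover (q : RSpace n) (hq : q ∈ segment ℝ y z) (hqc : q ∈ closure Ω) : q ∈ Ω := by
      by_contra hqΩ
      exact hemp hq ⟨hqc, by rwa [hΩ.interior_eq]⟩
    obtain ⟨q, -, h1, h2⟩ := (convex_segment y z).isPreconnected Ω (closure Ω)ᶜ hΩ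
      isClosed_closure.isOpen_compl
      (fun q hq => or_iff_not_imp_right.2 fun h => hcover q hq (not_not.1 h))
      ⟨y, left_mem_segment ℝ y z, hy⟩
      ⟨z, right_mem_segment ℝ y z, fun h => hzΩ (hcover z (right_mem_segment ℝ y z) h)⟩
    exact h2 (subset_closure h1)
  obtain ⟨q, hq, hqf⟩ := hseg
  calc infDist y (frontier Ω) ≤ dist y q := infDist_le_dist_of_mem hqf
    _ ≤ dist y z := by
      have := dist_add_dist_of_mem_segment hq
      linarith [dist_nonneg (x := q) (y := z)]
    _ = s := by
      rw [dist_eq_norm, hz, sub_sub_cancel, norm_smul, hv.1, mul_one,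
        Real.norm_of_nonneg hs0.le]

lemma IsNearestNormalMap.norm_eq_one {ν : RSpace n → RSpace n} (hν : IsNearestNormalMap Ω ν)
    {x : RSpace n} (hx : x ∈ Ω) : ‖ν x‖ = 1 := by
  obtain ⟨p, -, -, h, -⟩ := hν x hx
  exact h

/-- A nearest normal is a supergradient of the distance to the boundary. -/
lemma IsNearestNormalMap.infDist_frontier_le {ν : RSpace n → RSpace n}
    (hν : IsNearestNormalMap Ω ν) (hΩ : IsOpen Ω) {x y : RSpace n} (hx : x ∈ Ω) (hy : y ∈ Ω) :
    infDist y (frontier Ω) ≤ infDist x (frontier Ω) + inner ℝ (y - x) (ν x) := by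
  obtain ⟨p, -, hd, hp⟩ := hν x hx
  have h1 := hp.infDist_frontier_le hΩ hy
  have h2 : inner ℝ (x - p) (ν x) ≤ infDist x (frontier Ω) := by
    have := real_inner_le_norm (x - p) (ν x)
    rwa [hp.1, mul_one, ← dist_eq_norm, hd] at this
  have h3 : (inner ℝ (y - p) (ν x) : ℝ) = inner ℝ (y - x) (ν x) + inner ℝ (x - p) (ν x) := by
    rw [← inner_add_left, sub_add_sub_cancel]
  linarith [hp.infDist_frontier_le hΩ hx]

lemma IsNearestNormalMap.infDist_frontier_pos {ν : RSpace n → RSpace n}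
    (hν : IsNearestNormalMap Ω ν) (hΩ : IsOpen Ω) {x : RSpace n} (hx : x ∈ Ω) :
    0 < infDist x (frontier Ω) := by
  obtain ⟨p, hp, -⟩ := hν x hx
  refine (isClosed_frontier.notMem_iff_infDist_pos ⟨p, hp⟩).1 fun h => ?_
  have := hΩ.inter_frontier_eq ▸ mem_inter hx h
  exact this

/-- The distance to the boundary of a nonempty open set with nearest normals extends to a
concave `1`-Lipschitz function on the whole space. -/
lemma IsNearestNormalMap.exists_concave_extension {ν : RSpace n → RSpace n}
    (hν : IsNearestNormalMap Ω ν) (hΩ : IsOpen Ω) (hne : Ω.Nonempty) :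
    ∃ D : RSpace n → ℝ, LipschitzWith 1 D ∧ ConcaveOn ℝ univ D ∧
      (∀ x ∈ Ω, D x = infDist x (frontier Ω)) ∧
      ∀ x ∈ Ω, ∀ y, D y ≤ D x + inner ℝ (y - x) (ν x) := by
  set a : Ω → RSpace n → ℝ := fun x y => infDist x.1 (frontier Ω) + inner ℝ (y - x.1) (ν x)
    with ha
  have : Nonempty Ω := hne.to_subtype
  have haLip (x : Ω) (y z : RSpace n) : a x y ≤ a x z + dist y z := by
    have h := real_inner_le_norm (y - z) (ν x)
    rw [hν.norm_eq_one x.2, mul_one, ← dist_eq_norm] at h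
    have h3 : (inner ℝ (y - x.1) (ν x) : ℝ) = inner ℝ (y - z) (ν x) + inner ℝ (z - x.1) (ν x) := by
      rw [← inner_add_left, sub_add_sub_cancel]
    simp only [ha]
    linarith
  -- All these affine functions are 1-Lipschitz and, at a fixed point `y₀` of `Ω`, bounded below by
  -- its boundary distance.
  have hbdd (y : RSpace n) : BddBelow (range fun x => a x y) := by
    obtain ⟨y₀, hy₀⟩ := hne
    refine ⟨infDist y₀ (frontier Ω) - dist y₀ y, ?_⟩
    rintro _ ⟨x, rfl⟩
    have h1 := hν.infDist_frontier_le hΩ x.2 hy₀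
    have h2 := haLip x y₀ y
    simp only [ha] at h2 ⊢
    linarith
  have hD {x : RSpace n} (hx : x ∈ Ω) : ⨅ z, a z x = infDist x (frontier Ω) := by
    refine le_antisymm ((ciInf_le (hbdd x) ⟨x, hx⟩).trans (by simp [ha])) ?_
    exact le_ciInf fun z => hν.infDist_frontier_le hΩ z.2 hx
  refine ⟨fun y => ⨅ x, a x y, ?_, ⟨convex_univ, ?_⟩, fun x hx => hD hx, ?_⟩
  · refine LipschitzWith.of_le_add fun y z => ?_
    rw [← sub_le_iff_le_add]
    refine le_ciInf fun x => ?_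
    rw [sub_le_iff_le_add]
    exact (ciInf_le (hbdd y) x).trans (haLip x y z)
  · intro y _ z _ s t hs ht hst
    refine le_ciInf fun x => ?_
    have h1 := mul_le_mul_of_nonneg_left (ciInf_le (hbdd y) x) hs
    have h2 := mul_le_mul_of_nonneg_left (ciInf_le (hbdd z) x) ht
    have h3 : a x (s • y + t • z) = s * a x y + t * a x z := by
      have : s • y + t • z - x.1 = s • (y - x.1) + t • (z - x.1) := by
        rw [smul_sub, smul_sub, sub_add_sub_comm, ← add_smul, hst, one_smul]
      simp only [ha, this, inner_add_left, inner_smul_left, conj_trivial]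
      linear_combination -infDist x.1 (frontier Ω) * hst
    rw [h3]
    simpa only [smul_eq_mul] using add_le_add h1 h2
  · intro x hx y
    simp only [hD hx]
    exact ciInf_le (hbdd y) ⟨x, hx⟩

end ConcaveExtension

/-! ### First and second derivatives of concave functions. -/

section ConcaveGradient

variable {E : Type*} [NormedAddCommGroup E] [NormedSpace ℝ E]

/-- On the line through `x` in direction `v`, the secant slope over `[0, 1]` is at most the
derivative at the left endpoint. -/
lemma ConcaveOn.le_add_fderiv {f : E → ℝ} (hf : ConcaveOn ℝ univ f) {x : E}
    (hd : DifferentiableAt ℝ f x) (v : E) : f (x + v) ≤ f x + fderiv ℝ f x v := by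
  have hline : HasDerivAt (fun t : ℝ => f (x + t • v)) (fderiv ℝ f x v) 0 :=
    hd.hasFDerivAt.hasLineDerivAt v
  have hcon : ConcaveOn ℝ univ fun t : ℝ => f (x + t • v) := by
    have := hf.comp_affineMap (AffineMap.lineMap x (x + v))
    simpa [Function.comp_def, AffineMap.lineMap_apply, add_comm] using this
  have := hcon.slope_le_of_hasDerivAt (mem_univ 0) (mem_univ 1) zero_lt_one hline
  simp [slope_def_field] at this
  linarith

/-- A supergradient at a point of differentiability is the derivative. -/
lemma fderiv_eq_of_forall_le_add {f : E → ℝ} {x : E} (hd : DifferentiableAt ℝ f x)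
    {l : E →L[ℝ] ℝ} (hl : ∀ y, f y ≤ f x + l (y - x)) : fderiv ℝ f x = l := by
  have hmax : IsLocalMax (fun y => f y - l y) x := by
    refine Eventually.of_forall fun y => ?_
    have := hl y
    rw [map_sub] at this
    simp only
    linarith
  have h := hmax.fderiv_eq_zero
  rw [fderiv_fun_sub hd l.differentiableAt, l.fderiv, sub_eq_zero] at h
  exact h

/-- Derivatives of pointwise convergent differentiable concave functions converge at each point
of differentiability of the limit. -/
lemma tendsto_fderiv_apply_of_concaveOn {f : ℕ → E → ℝ} {g : E → ℝ}
    (hf : ∀ k, ConcaveOn ℝ univ (f k)) (hfd : ∀ k, Differentiable ℝ (f k))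
    (hlim : ∀ x, Tendsto (fun k => f k x) atTop (𝓝 (g x))) {x : E}
    (hg : DifferentiableAt ℝ g x) (v : E) :
    Tendsto (fun k => fderiv ℝ (f k) x v) atTop (𝓝 (fderiv ℝ g x v)) := by
  -- Some difference quotient of `g` with step `h > 0` exceeds `a`. By pointwise convergence so does
  -- that of `f k` eventually, and concavity bounds it by the derivative of `f k`.
  have key (v : E) (a : ℝ) (ha : a < fderiv ℝ g x v) :
      ∀ᶠ k in atTop, a < fderiv ℝ (f k) x v := by
    have hline : HasDerivAt (fun t : ℝ => g (x + t • v)) (fderiv ℝ g x v) 0 :=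
      hg.hasFDerivAt.hasLineDerivAt v
    have hslope := (hline.tendsto_slope_zero_right).eventually (lt_mem_nhds ha)
    obtain ⟨h, hh, hpos⟩ := (hslope.and self_mem_nhdsWithin).exists
    have hpos : 0 < h := hpos
    simp only [zero_add, zero_smul, add_zero, smul_eq_mul] at hh
    have hconv : Tendsto (fun k => h⁻¹ * (f k (x + h • v) - f k x)) atTop
        (𝓝 (h⁻¹ * (g (x + h • v) - g x))) :=
      ((hlim _).sub (hlim _)).const_mul _
    filter_upwards [hconv.eventually (lt_mem_nhds hh)] with k hk
    refine hk.trans_le ?_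
    have := (hf k).le_add_fderiv (hfd k x) (h • v)
    rw [map_smul, smul_eq_mul] at this
    rw [inv_mul_le_iff₀ hpos]
    linarith
  -- The upper bound is the lower bound in the direction `-v`.
  refine tendsto_order.2 ⟨fun a ha => key v a ha, fun a ha => ?_⟩
  filter_upwards [key (-v) (-a) (by simpa using ha)] with k hk
  simpa using hk

/-- The Hessian of a concave function is negative semidefinite. -/
lemma ConcaveOn.fderiv_fderiv_nonpos {f : E → ℝ} (hf : ConcaveOn ℝ univ f)
    (hd : ContDiff ℝ 2 f) (x v : E) : fderiv ℝ (fderiv ℝ f) x v v ≤ 0 := by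
  have hcon : ConcaveOn ℝ univ fun t : ℝ => f (x + t • v) := by
    have := hf.comp_affineMap (AffineMap.lineMap x (x + v))
    simpa [Function.comp_def, AffineMap.lineMap_apply, add_comm] using this
  have hline (t : ℝ) : HasDerivAt (fun t : ℝ => x + t • v) v t := by
    simpa using ((hasDerivAt_id t).smul_const v).const_add x
  have hderiv (t : ℝ) : HasDerivAt (fun t : ℝ => f (x + t • v)) (fderiv ℝ f (x + t • v) v) t :=
    ((hd.differentiable (by norm_num)) _).hasFDerivAt.comp_hasDerivAt t (hline t)
  have hanti : Antitone fun t : ℝ => fderiv ℝ f (x + t • v) v := by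
    have := hcon.antitoneOn_deriv fun t _ => (hderiv t).differentiableAt
    rw [antitoneOn_univ] at this
    convert this using 2 with t
    exact (hderiv t).deriv.symm
  have hd2 : Differentiable ℝ (fderiv ℝ f) :=
    (hd.fderiv_right (m := 1) (by norm_num)).differentiable (by norm_num)
  have h2 : HasDerivAt (fun t : ℝ => fderiv ℝ f (x + t • v) v)
      (fderiv ℝ (fderiv ℝ f) x v v) 0 := by
    have h := (hd2 (x + (0 : ℝ) • v)).hasFDerivAt.comp_hasDerivAt (0 : ℝ) (hline 0)
    rw [zero_smul, add_zero] at h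
    exact ((ContinuousLinearMap.apply ℝ ℝ v).hasFDerivAt.comp_hasDerivAt (0 : ℝ) h)
  rw [← h2.deriv]
  exact hanti.deriv_nonpos

end ConcaveGradient

/-! ### Smoothing that preserves concavity and the Lipschitz constant. -/

section Mollification

variable {E : Type*} [NormedAddCommGroup E] [InnerProductSpace ℝ E] [FiniteDimensional ℝ E]
  [MeasurableSpace E] [BorelSpace E]

open scoped Convolution in
/-- A concave `1`-Lipschitz function is approximated uniformly from above by smooth concave
`1`-Lipschitz functions. -/
lemma exists_contDiff_concave_approx {D : E → ℝ} (hL : LipschitzWith 1 D)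
    (hc : ConcaveOn ℝ univ D) {ε : ℝ} (hε : 0 < ε) :
    ∃ f : E → ℝ, ContDiff ℝ ∞ f ∧ LipschitzWith 1 f ∧ ConcaveOn ℝ univ f ∧
      ∀ x, D x ≤ f x ∧ f x ≤ D x + ε := by
  -- With outer radius `ε / 2`, mollifying moves the 1-Lipschitz `D` by at most `ε / 2`; adding `ε /
  -- 2` afterwards places the result between `D` and `D + ε`.
  let φ : ContDiffBump (0 : E) := ⟨ε / 4, ε / 2, by positivity, by linarith⟩
  let ρ : E → ℝ := φ.normed volume
  have hρc : Continuous ρ := φ.continuous_normed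
  have hρs : HasCompactSupport ρ := φ.hasCompactSupport_normed
  have hρ0 (t : E) : 0 ≤ ρ t := φ.nonneg_normed t
  have hint (x : E) : Integrable fun t => ρ t * D (x - t) := by
    apply Continuous.integrable_of_hasCompactSupport
    · exact hρc.mul (hL.continuous.comp (by fun_prop))
    · exact hρs.mul_right
  have hconv (x : E) : (ρ ⋆[ContinuousLinearMap.lsmul ℝ ℝ, volume] D) x
      = ∫ t, ρ t * D (x - t) := rfl
  have hdist (x : E) : |(∫ t, ρ t * D (x - t)) - D x| ≤ ε / 2 := by
    rw [← hconv, ← Real.dist_eq]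
    apply φ.dist_normed_convolution_le hL.continuous.aestronglyMeasurable
    intro y hy
    have := hL.dist_le_mul y x
    rw [NNReal.coe_one, one_mul] at this
    exact this.trans (mem_ball.1 hy).le
  have hone : ∫ t, ρ t = 1 := φ.integral_normed
  have hρi : Integrable ρ := hρc.integrable_of_hasCompactSupport hρs
  refine ⟨fun x => (∫ t, ρ t * D (x - t)) + ε / 2, ?_, ?_, ⟨convex_univ, ?_⟩, fun x => ?_⟩
  · refine ContDiff.add ?_ contDiff_const
    simp only [← hconv]
    exact hρs.contDiff_convolution_left _ φ.contDiff_normed hL.continuous.locallyIntegrable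
  · refine LipschitzWith.of_le_add fun y z => ?_
    have : ∫ t, ρ t * D (y - t) ≤ ∫ t, (ρ t * D (z - t) + ρ t * dist y z) := by
      refine integral_mono (hint y) ((hint z).add (hρi.mul_const _)) fun t => ?_
      have h1 : D (y - t) ≤ D (z - t) + dist y z := by
        have := hL.le_add_mul (y - t) (z - t)
        simpa using this
      simp only [← mul_add]
      exact mul_le_mul_of_nonneg_left h1 (hρ0 t)
    rw [integral_add (hint z) (hρi.mul_const _), integral_mul_const, hone, one_mul] at this
    linarith
  · intro y _ z _ a b ha hb hab
    have : ∫ t, (a * (ρ t * D (y - t)) + b * (ρ t * D (z - t))) ≤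
        ∫ t, ρ t * D (a • y + b • z - t) := by
      refine integral_mono (((hint y).const_mul a).add ((hint z).const_mul b)) (hint _)
        fun t => ?_
      have h1 := hc.2 (mem_univ (y - t)) (mem_univ (z - t)) ha hb hab
      have h2 : a • (y - t) + b • (z - t) = a • y + b • z - t := by
        rw [smul_sub, smul_sub, sub_add_sub_comm, ← add_smul, hab, one_smul]
      rw [h2, smul_eq_mul, smul_eq_mul] at h1
      have := mul_le_mul_of_nonneg_left h1 (hρ0 t)
      simp only
      linarith
    rw [integral_add ((hint y).const_mul a) ((hint z).const_mul b), integral_const_mul,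
      integral_const_mul] at this
    simp only [smul_eq_mul]
    have h3 : a * (ε / 2) + b * (ε / 2) = ε / 2 := by rw [← add_mul, hab, one_mul]
    linarith
  · have := abs_le.1 (hdist x)
    constructor <;> linarith

end Mollification

/-! ### Homogeneity of the left-invariant fields. -/

section JacobianField

variable {n : ℕ}

/-- The dilation as a continuous linear map. -/
noncomputable def anisotropicDilationCLM (w : Fin n → ℕ) (t : ℝ) : RSpace n →L[ℝ] RSpace n :=
  LinearMap.toContinuousLinearMap
    { toFun := anisotropicDilation w t
      map_add' := fun x y => by ext j; simp [anisotropicDilation, mul_add]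
      map_smul' := fun c x => by ext j; simp [anisotropicDilation, mul_left_comm] }

@[simp]
lemma anisotropicDilationCLM_apply (w : Fin n → ℕ) (t : ℝ) (x : RSpace n) :
    anisotropicDilationCLM w t x = anisotropicDilation w t x := rfl

lemma anisotropicDilation_single (w : Fin n → ℕ) (t : ℝ) (j : Fin n) :
    anisotropicDilation w t (EuclideanSpace.single j 1) =
      t ^ w j • EuclideanSpace.single j 1 := by
  ext k
  by_cases h : k = j
  · subst h; simp [anisotropicDilation]
  · simp [anisotropicDilation, h]

lemma contDiff_jacobianField {mul : RSpace n → RSpace n → RSpace n}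
    (hmul : ContDiff ℝ ∞ fun p : RSpace n × RSpace n => mul p.1 p.2) (j : Fin n) :
    ContDiff ℝ ∞ (jacobianField mul j) := by
  unfold jacobianField
  have : ContDiff ℝ ∞ fun x => fderiv ℝ (mul x) 0 :=
    ContDiff.fderiv (m := ∞) (n := ∞) (f := mul) hmul contDiff_const (by simp)
  exact this.clm_apply contDiff_const

/-- The members of the Jacobian basis are homogeneous with respect to the dilations. -/
lemma anisotropicDilation_jacobianField {mul : RSpace n → RSpace n → RSpace n}
    (hmul : ContDiff ℝ ∞ fun p : RSpace n × RSpace n => mul p.1 p.2) {w : Fin n → ℕ} {t : ℝ}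
    (hdil : ∀ x y, anisotropicDilation w t (mul x y) =
      mul (anisotropicDilation w t x) (anisotropicDilation w t y)) (j : Fin n) (x : RSpace n) :
    anisotropicDilation w t (jacobianField mul j x) =
      t ^ w j • jacobianField mul j (anisotropicDilation w t x) := by
  have hd (x : RSpace n) : Differentiable ℝ (mul x) :=
    (hmul.comp (contDiff_prodMk_right x)).differentiable (by simp)
  have h1 : HasFDerivAt (fun y => anisotropicDilation w t (mul x y))
      ((anisotropicDilationCLM w t).comp (fderiv ℝ (mul x) 0)) 0 :=
    (anisotropicDilationCLM w t).hasFDerivAt.comp 0 (hd x 0).hasFDerivAt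
  have h2 : HasFDerivAt (fun y => anisotropicDilation w t (mul x y))
      ((fderiv ℝ (mul (anisotropicDilation w t x)) 0).comp (anisotropicDilationCLM w t)) 0 := by
    simp only [hdil]
    have h := (hd (anisotropicDilation w t x) (anisotropicDilationCLM w t 0)).hasFDerivAt.comp
      (0 : RSpace n) (anisotropicDilationCLM w t).hasFDerivAt
    rwa [map_zero] at h
  -- The automorphism identity has been differentiated at `y = 0` in two ways; the derivatives are
  -- compared on `e_j`, which the dilation scales by `t ^ w j`.
  have h := congrArg (fun L => L (EuclideanSpace.single j 1)) (h1.unique h2)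
  simpa [anisotropicDilation_single, jacobianField] using h

end JacobianField

/-! ### Divergence-free generators and integration by parts. -/

namespace StratifiedGroup

variable {n : ℕ} (G : StratifiedGroup n)

lemma contDiff_X (i : G.FirstStratum) : ContDiff ℝ ∞ (G.X i) :=
  contDiff_jacobianField G.contDiff_mul i.1

/-- By homogeneity the `k`-th coefficient of `X_i` does not depend on the `k`-th coordinate. -/
lemma fderiv_X_single_apply (i : G.FirstStratum) (x : RSpace n) (k : Fin n) :
    fderiv ℝ (G.X i) x (EuclideanSpace.single k 1) k = 0 := by
  set g : RSpace n → ℝ := fun x => fderiv ℝ (G.X i) x (EuclideanSpace.single k 1) k with hg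
  have hXd : Differentiable ℝ (G.X i) := (G.contDiff_X i).differentiable (by simp)
  -- Differentiating `δ X_i = t (X_i ∘ δ)` and reading off the `(k, k)` entry, the factor `t ^ w_k`
  -- occurs on both sides and cancels. Letting `t → 0` then forces `g x = 0`.
  have hscale (t : ℝ) (ht : 0 < t) : g x = t * g (anisotropicDilation G.weight t x) := by
    set δ := anisotropicDilationCLM G.weight t
    have hom (y : RSpace n) : δ (G.X i y) = t • G.X i (δ y) := by
      have := anisotropicDilation_jacobianField G.contDiff_mul (G.dilation_mul t ht) i.1 y
      rwa [i.2, pow_one] at this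
    have h1 : HasFDerivAt (fun y => δ (G.X i y)) (δ.comp (fderiv ℝ (G.X i) x)) x :=
      δ.hasFDerivAt.comp x (hXd x).hasFDerivAt
    have h2 : HasFDerivAt (fun y => δ (G.X i y)) (t • (fderiv ℝ (G.X i) (δ x)).comp δ) x := by
      simp only [hom]
      exact ((hXd (δ x)).hasFDerivAt.comp x δ.hasFDerivAt).const_smul t
    have h := congrArg (fun L => L (EuclideanSpace.single k 1) k) (h1.unique h2)
    have h3 : t ^ G.weight k * g x = t * (t ^ G.weight k * g (δ x)) := by
      have hs : δ (EuclideanSpace.single k 1) =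
          t ^ G.weight k • EuclideanSpace.single k 1 := anisotropicDilation_single _ _ _
      simp only [ContinuousLinearMap.comp_apply, FunLike.coe_smul, Pi.smul_apply, hs, map_smul,
        PiLp.smul_apply, smul_eq_mul] at h
      exact h
    have h4 : t ^ G.weight k ≠ 0 := (pow_pos ht _).ne'
    apply mul_left_cancel₀ h4
    rw [h3, mul_left_comm]; rfl
  have hgc : Continuous g := by
    have h1 : Continuous (fderiv ℝ (G.X i)) := (G.contDiff_X i).continuous_fderiv (by simp)
    have h2 : Continuous fun x => fderiv ℝ (G.X i) x (EuclideanSpace.single k 1) := by fun_prop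
    exact (EuclideanSpace.proj k).continuous.comp h2
  have hδ : Continuous fun t : ℝ => anisotropicDilation G.weight t x := by
    unfold anisotropicDilation
    fun_prop
  have hlim : Tendsto (fun t : ℝ => t * g (anisotropicDilation G.weight t x)) (𝓝[>] 0) (𝓝 0) := by
    have : Continuous fun t : ℝ => t * g (anisotropicDilation G.weight t x) :=
      continuous_id.mul (hgc.comp hδ)
    have h := this.tendsto 0
    rw [zero_mul] at h
    exact h.mono_left nhdsWithin_le_nhds
  refine tendsto_nhds_unique (tendsto_const_nhds.congr' ?_) hlim
  filter_upwards [self_mem_nhdsWithin] with t ht using hscale t ht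

end StratifiedGroup

/-- A divergence-free field integrates compactly supported functions to zero. -/
lemma integral_fderiv_apply_eq_zero {n : ℕ} {X : RSpace n → RSpace n} (hX : ContDiff ℝ 1 X)
    (hdiv : ∀ x k, fderiv ℝ X x (EuclideanSpace.single k 1) k = 0) {f : RSpace n → ℝ}
    (hf : ContDiff ℝ 1 f) (hfc : HasCompactSupport f) : ∫ x, fderiv ℝ f x (X x) = 0 := by
  have hXd : Differentiable ℝ X := hX.differentiable one_ne_zero
  have hXk (k : Fin n) : Differentiable ℝ fun x => X x k := fun x => by fun_prop
  have hdivk (k : Fin n) (x : RSpace n) :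
      fderiv ℝ (fun x => X x k) x (EuclideanSpace.single k 1) = 0 := by
    have : HasFDerivAt (fun x => X x k)
        ((EuclideanSpace.proj k : RSpace n →L[ℝ] ℝ).comp (fderiv ℝ X x)) x :=
      (EuclideanSpace.proj k : RSpace n →L[ℝ] ℝ).hasFDerivAt.comp x (hXd x).hasFDerivAt
    rw [this.fderiv]
    exact hdiv x k
  have hf' : Continuous (fderiv ℝ f) := hf.continuous_fderiv one_ne_zero
  have hcont (k : Fin n) :
      Continuous fun x => X x k * fderiv ℝ f x (EuclideanSpace.single k 1) := by
    have := (hXk k).continuous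
    fun_prop
  have hint (k : Fin n) :
      Integrable fun x => X x k * fderiv ℝ f x (EuclideanSpace.single k 1) :=
    (hcont k).integrable_of_hasCompactSupport
      ((hfc.fderiv_apply (𝕜 := ℝ) (EuclideanSpace.single k 1)).mul_left)
  have hsum (x : RSpace n) :
      fderiv ℝ f x (X x) = ∑ k, X x k * fderiv ℝ f x (EuclideanSpace.single k 1) := by
    conv_lhs => rw [← (EuclideanSpace.basisFun (Fin n) ℝ).sum_repr (X x)]
    simp
  simp only [hsum]
  rw [integral_finsetSum _ fun k _ => hint k]
  refine Finset.sum_eq_zero fun k _ => ?_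
  rw [integral_mul_fderiv_eq_neg_fderiv_mul_of_integrable (by simp [hdivk]) (hint k)
    (((hXk k).continuous.mul hf.continuous).integrable_of_hasCompactSupport hfc.mul_left)
    (fun x _ => hXk k x) (fun x _ => hf.differentiable one_ne_zero x)]
  simp [hdivk]

/-! ### Completing the square, and the derivative of the test coefficient. -/

section Pointwise

variable {E : Type*} [NormedAddCommGroup E] [NormedSpace ℝ E] {𝕜 : Type*} [RCLike 𝕜]

/-- This is `|∂_v u - f u|² ≥ 0`, expanded for the real and imaginary parts separately. -/
lemma fderiv_mul_norm_sq_apply_le {f : E → ℝ} {u : E → 𝕜} {x : E}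
    (hf : DifferentiableAt ℝ f x) (hu : DifferentiableAt ℝ u x) (v : E) :
    fderiv ℝ (fun y => f y * ‖u y‖ ^ 2) x v ≤
      ‖fderiv ℝ u x v‖ ^ 2 + (fderiv ℝ f x v + f x ^ 2) * ‖u x‖ ^ 2 := by
  have hre : HasFDerivAt (fun y => RCLike.re (u y))
      ((RCLike.reCLM (K := 𝕜)).comp (fderiv ℝ u x)) x :=
    (RCLike.reCLM (K := 𝕜)).hasFDerivAt.comp x hu.hasFDerivAt
  have him : HasFDerivAt (fun y => RCLike.im (u y))
      ((RCLike.imCLM (K := 𝕜)).comp (fderiv ℝ u x)) x :=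
    (RCLike.imCLM (K := 𝕜)).hasFDerivAt.comp x hu.hasFDerivAt
  have h := hf.hasFDerivAt.mul ((hre.mul hre).add (him.mul him))
  have heq : (fun y => f y * ‖u y‖ ^ 2) = fun y =>
      f y * (RCLike.re (u y) * RCLike.re (u y) + RCLike.im (u y) * RCLike.im (u y)) := by
    simp only [RCLike.norm_sq_eq_def]
  rw [heq]
  erw [h.fderiv]
  simp only [RCLike.norm_sq_eq_def, add_apply, FunLike.coe_smul, Pi.smul_apply, Pi.add_apply,
    Pi.mul_apply, ContinuousLinearMap.comp_apply,
    RCLike.reCLM_apply, RCLike.imCLM_apply, smul_eq_mul]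
  nlinarith [sq_nonneg (RCLike.re (fderiv ℝ u x v) - f x * RCLike.re (u x)),
    sq_nonneg (RCLike.im (fderiv ℝ u x v) - f x * RCLike.im (u x))]

/-- The derivative of the vector field coefficient `-β X φ / φ` along `X`. -/
lemma fderiv_neg_mul_div_apply {φ : E → ℝ} {X : E → E} {x : E} (β : ℝ) (hφ : ContDiff ℝ 2 φ)
    (hX : DifferentiableAt ℝ X x) (h0 : φ x ≠ 0) :
    DifferentiableAt ℝ (fun y => -β * (fderiv ℝ φ y (X y) / φ y)) x ∧
    fderiv ℝ (fun y => -β * (fderiv ℝ φ y (X y) / φ y)) x (X x) =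
      -β * ((fderiv ℝ (fderiv ℝ φ) x (X x) (X x) + fderiv ℝ φ x (fderiv ℝ X x (X x))) / φ x
        - (fderiv ℝ φ x (X x)) ^ 2 / φ x ^ 2) := by
  have hφ1 : HasFDerivAt φ (fderiv ℝ φ x) x := (hφ.differentiable (by norm_num) x).hasFDerivAt
  have hφ2 : HasFDerivAt (fderiv ℝ φ) (fderiv ℝ (fderiv ℝ φ) x) x :=
    ((hφ.fderiv_right (m := 1) (by norm_num)).differentiable (by norm_num) x).hasFDerivAt
  have h := ((hφ2.clm_apply hX.hasFDerivAt).mul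
    ((hasDerivAt_inv h0).comp_hasFDerivAt x hφ1)).const_mul (-β)
  have heq : (fun y => -β * (fderiv ℝ φ y (X y) / φ y)) =
      fun y => -β * (fderiv ℝ φ y (X y) * (φ y)⁻¹) := by simp only [div_eq_mul_inv]
  rw [heq]
  refine ⟨h.differentiableAt, ?_⟩
  erw [h.fderiv]
  simp
  field_simp
  ring

end Pointwise

/-! ### The two weights as functions of distance, normal and position. -/

section HardyWeights

variable {n : ℕ} (G : StratifiedGroup n)

/-- The weight `∑ i, ⟨X_i(x), v⟩ ^ 2 / p ^ 2` as a function of `(p, v, x)`. -/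
noncomputable def angleWeight (q : ℝ × RSpace n × RSpace n) : ℝ :=
  (∑ i, (inner ℝ (G.X i q.2.2) q.2.1) ^ 2) / q.1 ^ 2

/-- The weight `∑ i, X_i⟨X_i(x), v⟩ / p` as a function of `(p, v, x)`. -/
noncomputable def driftWeight (q : ℝ × RSpace n × RSpace n) : ℝ :=
  ∑ i, inner ℝ (fderiv ℝ (G.X i) q.2.2 (G.X i q.2.2)) q.2.1 / q.1

/-- Continuity on `p > 0` is all that the passage to the limit needs from a weight, so both weights
are handled by the same convergence lemma. -/
lemma continuousOn_angleWeight : ContinuousOn (angleWeight G) {q | 0 < q.1} := by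
  have h (i : G.FirstStratum) : Continuous (G.X i) := (G.contDiff_X i).continuous
  refine ContinuousOn.div (Continuous.continuousOn ?_) (by fun_prop)
    fun q hq => (pow_pos hq 2).ne'
  fun_prop

lemma continuousOn_driftWeight : ContinuousOn (driftWeight G) {q | 0 < q.1} := by
  have h (i : G.FirstStratum) : Continuous (G.X i) := (G.contDiff_X i).continuous
  have h' (i : G.FirstStratum) : Continuous (fderiv ℝ (G.X i)) :=
    (G.contDiff_X i).continuous_fderiv (by simp)
  refine continuousOn_finsetSum _ fun i _ => ContinuousOn.div (Continuous.continuousOn ?_)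
    (by fun_prop) fun q hq => ne_of_gt hq
  fun_prop

end HardyWeights

/-! ### The Hardy inequality for smooth concave weights. -/

section SmoothWeight

variable {n : ℕ} (G : StratifiedGroup n) {𝕜 : Type*} [RCLike 𝕜] {Ω : Set (RSpace n)}
  {u : RSpace n → 𝕜}

lemma integrable_norm_sq_horizontalGradient (hu : ContDiff ℝ ∞ u)
    (hu_compact : HasCompactSupport u) :
    Integrable fun x => ‖G.horizontalGradient u x‖ ^ 2 := by
  have h (i : G.FirstStratum) : Continuous (G.X i) := (G.contDiff_X i).continuous
  have h' : Continuous (fderiv ℝ u) := hu.continuous_fderiv (by simp)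
  have hc : Continuous (G.horizontalGradient u) := by
    unfold StratifiedGroup.horizontalGradient StratifiedGroup.XDeriv
    fun_prop
  refine (hc.norm.pow 2).integrable_of_hasCompactSupport ?_
  refine (hu_compact.fderiv (𝕜 := ℝ)).mono fun x hx => ?_
  contrapose! hx
  rw [Function.notMem_support] at hx ⊢
  have : G.horizontalGradient u x = 0 := by
    ext i
    simp [StratifiedGroup.horizontalGradient, StratifiedGroup.XDeriv, hx]
  simp [this]

/-- Hardy inequality for a smooth concave weight function which is positive on `Ω`. -/
lemma integral_hardyWeight_le_of_contDiff (hΩ : IsOpen Ω) {β : ℝ} (hβ : β < 0)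
    (hu : ContDiff ℝ ∞ u) (hu_compact : HasCompactSupport u) (hu_supp : tsupport u ⊆ Ω)
    {φ : RSpace n → ℝ} (hφ : ContDiff ℝ ∞ φ) (hφc : ConcaveOn ℝ univ φ)
    (hφ0 : ∀ x ∈ Ω, 0 < φ x)
    (hi₁ : IntegrableOn (fun x => angleWeight G (φ x, gradient φ x, x) * ‖u x‖ ^ 2) Ω)
    (hi₂ : IntegrableOn (fun x => driftWeight G (φ x, gradient φ x, x) * ‖u x‖ ^ 2) Ω) :
    -(β ^ 2 + β) * (∫ x in Ω, angleWeight G (φ x, gradient φ x, x) * ‖u x‖ ^ 2) +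
      β * (∫ x in Ω, driftWeight G (φ x, gradient φ x, x) * ‖u x‖ ^ 2) ≤
    ∫ x in Ω, ‖G.horizontalGradient u x‖ ^ 2 := by
  have hφ2 : ContDiff ℝ 2 φ := contDiff_infty.1 hφ 2
  have hXd (i : G.FirstStratum) : Differentiable ℝ (G.X i) :=
    (G.contDiff_X i).differentiable (by simp)
  set f : G.FirstStratum → RSpace n → ℝ :=
    fun i y => -β * (fderiv ℝ φ y (G.X i y) / φ y) with hf
  set F : G.FirstStratum → RSpace n → ℝ := fun i y => f i y * ‖u y‖ ^ 2 with hF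
  have hFzero (i : G.FirstStratum) : ∀ x ∉ tsupport u, F i =ᶠ[𝓝 x] fun _ => 0 := by
    intro x hx
    filter_upwards [(isClosed_tsupport u).isOpen_compl.mem_nhds hx] with y hy
    simp [hF, image_eq_zero_of_notMem_tsupport hy]
  -- The quotient is harmless: `φ > 0` on the support of `u`, and `F i` vanishes near every other
  -- point.
  have hFsmooth (i : G.FirstStratum) : ContDiff ℝ 1 (F i) := by
    rw [contDiff_iff_contDiffAt]
    intro x
    by_cases hx : x ∈ tsupport u
    · have h0 := hφ0 x (hu_supp hx)
      have h1 : ContDiffAt ℝ 1 (fun y => fderiv ℝ φ y (G.X i y)) x :=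
        ((hφ2.fderiv_right (m := 1) (by norm_num)).clm_apply
          ((G.contDiff_X i).of_le (by exact_mod_cast le_top))).contDiffAt
      have h2 : ContDiffAt ℝ 1 φ x := (hφ.of_le (by exact_mod_cast le_top)).contDiffAt
      have h3 : ContDiff ℝ 1 fun y => ‖u y‖ ^ 2 := by
        have hu1 : ContDiff ℝ 1 u := hu.of_le (by exact_mod_cast le_top)
        simp only [RCLike.norm_sq_eq_def]
        have hr : ContDiff ℝ 1 fun y => RCLike.re (u y) :=
          (RCLike.reCLM (K := 𝕜)).contDiff.comp hu1
        have hm : ContDiff ℝ 1 fun y => RCLike.im (u y) :=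
          (RCLike.imCLM (K := 𝕜)).contDiff.comp hu1
        exact (hr.mul hr).add (hm.mul hm)
      exact (contDiffAt_const.mul (h1.div h2 h0.ne')).mul h3.contDiffAt
    · exact contDiffAt_const.congr_of_eventuallyEq (hFzero i x hx)
  have hFcompact (i : G.FirstStratum) : HasCompactSupport (F i) :=
    hu_compact.mono fun x hx => by
      contrapose! hx
      rw [Function.notMem_support] at hx ⊢
      simp [hF, hx]
  have hdF (i : G.FirstStratum) : ∫ x in Ω, fderiv ℝ (F i) x (G.X i x) = 0 := by
    rw [setIntegral_eq_integral_of_forall_compl_eq_zero fun x hx => by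
      rw [(hFzero i x fun h => hx (hu_supp h)).fderiv_eq]; simp]
    exact integral_fderiv_apply_eq_zero ((G.contDiff_X i).of_le (by exact_mod_cast le_top))
      (G.fderiv_X_single_apply i) (hFsmooth i) (hFcompact i)
  have hdFi (i : G.FirstStratum) :
      IntegrableOn (fun x => fderiv ℝ (F i) x (G.X i x)) Ω := by
    refine Integrable.integrableOn (Continuous.integrable_of_hasCompactSupport ?_ ?_)
    · exact ((hFsmooth i).continuous_fderiv one_ne_zero).clm_apply (G.contDiff_X i).continuous
    · refine ((hFcompact i).fderiv (𝕜 := ℝ)).mono fun x hx => ?_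
      contrapose! hx
      rw [Function.notMem_support] at hx ⊢
      simp [hx]
  have hpoint (x : RSpace n) (hx : x ∈ Ω) :
      -(β ^ 2 + β) * (angleWeight G (φ x, gradient φ x, x) * ‖u x‖ ^ 2) +
        β * (driftWeight G (φ x, gradient φ x, x) * ‖u x‖ ^ 2) +
        ∑ i, fderiv ℝ (F i) x (G.X i x) ≤ ‖G.horizontalGradient u x‖ ^ 2 := by
    have h0 := hφ0 x hx
    have hgrad (v : RSpace n) : inner ℝ v (gradient φ x) = fderiv ℝ φ x v := by
      rw [real_inner_comm]; exact InnerProductSpace.toDual_symm_apply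
    simp only [angleWeight, driftWeight, hgrad, EuclideanSpace.norm_sq_eq]
    rw [Finset.sum_div, Finset.sum_mul, Finset.sum_mul, Finset.mul_sum, Finset.mul_sum,
      ← Finset.sum_add_distrib, ← Finset.sum_add_distrib]
    refine Finset.sum_le_sum fun i _ => ?_
    obtain ⟨hfd, hfX⟩ := fderiv_neg_mul_div_apply β hφ2 (hXd i x) h0.ne'
    have h1 := fderiv_mul_norm_sq_apply_le hfd (hu.differentiable (by simp) x) (G.X i x)
    rw [hfX] at h1
    -- The Hessian term has a favourable sign, as a product of the two nonpositive factors `β` and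
    -- `D²φ(X_i, X_i)`; this is where `β < 0` enters.
    have h2 : 0 ≤ β * fderiv ℝ (fderiv ℝ φ) x (G.X i x) (G.X i x) / φ x * ‖u x‖ ^ 2 :=
      mul_nonneg (div_nonneg (mul_nonneg_of_nonpos_of_nonpos hβ.le
        (hφc.fderiv_fderiv_nonpos hφ2 x _)) h0.le) (sq_nonneg _)
    simp only [StratifiedGroup.horizontalGradient, StratifiedGroup.XDeriv]
    change _ + fderiv ℝ (fun y => f i y * ‖u y‖ ^ 2) x (G.X i x) ≤ _
    -- In the coefficient `β² + β`, the `β²` comes from `f_i²` and the `β` from differentiating `1 /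
    -- φ`.
    have h3 : (-β * ((fderiv ℝ (fderiv ℝ φ) x (G.X i x) (G.X i x) +
        fderiv ℝ φ x (fderiv ℝ (G.X i) x (G.X i x))) / φ x
        - (fderiv ℝ φ x (G.X i x)) ^ 2 / φ x ^ 2) +
        (-β * (fderiv ℝ φ x (G.X i x) / φ x)) ^ 2) * ‖u x‖ ^ 2 =
        -(-(β ^ 2 + β) * ((fderiv ℝ φ x (G.X i x)) ^ 2 / φ x ^ 2 * ‖u x‖ ^ 2) +
          β * (fderiv ℝ φ x (fderiv ℝ (G.X i) x (G.X i x)) / φ x * ‖u x‖ ^ 2)) -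
        β * fderiv ℝ (fderiv ℝ φ) x (G.X i x) (G.X i x) / φ x * ‖u x‖ ^ 2 := by
      field_simp
      ring
    rw [h3] at h1
    linarith
  have hsum : IntegrableOn (fun x => ∑ i, fderiv ℝ (F i) x (G.X i x)) Ω :=
    integrable_finsetSum _ fun i _ => hdFi i
  have hmono := setIntegral_mono_on (((hi₁.const_mul (-(β ^ 2 + β))).add (hi₂.const_mul β)).add
    hsum) (integrable_norm_sq_horizontalGradient G hu hu_compact).integrableOn
    hΩ.measurableSet hpoint
  rw [integral_add' ((hi₁.const_mul (-(β ^ 2 + β))).add (hi₂.const_mul β)) hsum,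
    integral_add' (hi₁.const_mul (-(β ^ 2 + β))) (hi₂.const_mul β), integral_const_mul,
    integral_const_mul, integral_finsetSum _ fun i _ => hdFi i] at hmono
  simpa [hdF] using hmono

end SmoothWeight

/-! ### Convergence of gradients and of the weighted integrals. -/

section Limit

variable {n : ℕ} {Ω : Set (RSpace n)}

lemma norm_gradient_le_of_lipschitz {φ : RSpace n → ℝ} (hφ : LipschitzWith 1 φ) (x : RSpace n) :
    ‖gradient φ x‖ ≤ 1 := by
  rw [gradient, LinearIsometryEquiv.norm_map]
  simpa using norm_fderiv_le_of_lipschitz ℝ (x₀ := x) hφ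

/-- The coordinates of the gradient are directional derivatives, so convergence in each direction
suffices. -/
lemma tendsto_gradient_of_concaveOn {φ : ℕ → RSpace n → ℝ} {D : RSpace n → ℝ}
    (hφ : ∀ k, ConcaveOn ℝ univ (φ k)) (hφd : ∀ k, Differentiable ℝ (φ k))
    (hlim : ∀ x, Tendsto (fun k => φ k x) atTop (𝓝 (D x))) {x : RSpace n}
    (hD : DifferentiableAt ℝ D x) :
    Tendsto (fun k => gradient (φ k) x) atTop (𝓝 (gradient D x)) := by
  have hcoord (f : RSpace n → ℝ) :
      gradient f x = WithLp.toLp 2 fun j => fderiv ℝ f x (EuclideanSpace.single j 1) := by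
    ext j
    have : inner ℝ (gradient f x) (EuclideanSpace.single j 1) =
      fderiv ℝ f x (EuclideanSpace.single j 1) := InnerProductSpace.toDual_symm_apply
    rw [EuclideanSpace.inner_single_right, one_mul, conj_trivial] at this
    exact this
  simp only [hcoord]
  exact ((PiLp.continuous_toLp 2 _).tendsto _).comp
    (tendsto_pi_nhds.2 fun j => tendsto_fderiv_apply_of_concaveOn hφ hφd hlim hD _)

/-- Dominated convergence for weights depending continuously on a positive function, its gradient
and the point, along a locally uniformly positive and equi-Lipschitz sequence. -/
lemma tendsto_integral_weight (hΩ : IsOpen Ω) {A : ℝ × RSpace n × RSpace n → ℝ}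
    (hA : ContinuousOn A {q | 0 < q.1}) {w : RSpace n → ℝ} (hw : Continuous w)
    (hwc : HasCompactSupport w) (hwΩ : tsupport w ⊆ Ω) {D : RSpace n → ℝ} (hD : Continuous D)
    (hD0 : ∀ x ∈ Ω, 0 < D x) {φ : ℕ → RSpace n → ℝ} (hφ : ∀ k, ContDiff ℝ ∞ (φ k))
    (hφL : ∀ k, LipschitzWith 1 (φ k)) (hDφ : ∀ k x, D x ≤ φ k x ∧ φ k x ≤ D x + 1)
    (hlim : ∀ x, Tendsto (fun k => φ k x) atTop (𝓝 (D x))) {ν : RSpace n → RSpace n}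
    (hν : ∀ᵐ x ∂(volume.restrict Ω), Tendsto (fun k => gradient (φ k) x) atTop (𝓝 (ν x))) :
    (∀ k, IntegrableOn (fun x => A (φ k x, gradient (φ k) x, x) * w x) Ω) ∧
    IntegrableOn (fun x => A (D x, ν x, x) * w x) Ω ∧
    Tendsto (fun k => ∫ x in Ω, A (φ k x, gradient (φ k) x, x) * w x) atTop
      (𝓝 (∫ x in Ω, A (D x, ν x, x) * w x)) := by
  -- A compact set in `p > 0` containing every triple `(φ k x, ∇φ k x, x)` with `x` in the support
  -- of `w`; the bound of `A` on it gives a dominating function independent of `k`.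
  set T : Set (ℝ × RSpace n × RSpace n) :=
    (fun q : ℝ × RSpace n × RSpace n => (D q.2.2 + q.1, q.2.1, q.2.2)) ''
      (Icc 0 1 ×ˢ closedBall 0 1 ×ˢ tsupport w) with hT
  have hTc : IsCompact T := by
    refine IsCompact.image ?_ (by fun_prop)
    exact isCompact_Icc.prod ((isCompact_closedBall _ _).prod hwc)
  have hTpos : T ⊆ {q | 0 < q.1} := by
    rintro _ ⟨⟨s, v, x⟩, ⟨hs, -, hx⟩, rfl⟩
    exact add_pos_of_pos_of_nonneg (hD0 x (hwΩ hx)) hs.1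
  obtain ⟨C, hC⟩ := hTc.exists_bound_of_continuousOn (hA.mono hTpos)
  have hbound (k : ℕ) (x : RSpace n) : ‖A (φ k x, gradient (φ k) x, x) * w x‖ ≤ C * ‖w x‖ := by
    by_cases hx : x ∈ tsupport w
    · rw [norm_mul]
      refine mul_le_mul_of_nonneg_right (hC _ ?_) (norm_nonneg _)
      refine ⟨(φ k x - D x, gradient (φ k) x, x), ⟨⟨?_, ?_⟩, ?_, hx⟩, by simp⟩
      · linarith [(hDφ k x).1]
      · linarith [(hDφ k x).2]
      · simpa using norm_gradient_le_of_lipschitz (hφL k) x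
    · simp [image_eq_zero_of_notMem_tsupport hx]
  have hmeas (k : ℕ) : AEStronglyMeasurable (fun x => A (φ k x, gradient (φ k) x, x) * w x)
      (volume.restrict Ω) := by
    refine ContinuousOn.aestronglyMeasurable (ContinuousOn.mul ?_ hw.continuousOn)
      hΩ.measurableSet
    have hgrad : Continuous (gradient (φ k)) :=
      (InnerProductSpace.toDual ℝ (RSpace n)).symm.continuous.comp
        ((hφ k).continuous_fderiv (by simp))
    have hφc := (hφ k).continuous
    exact hA.comp (by fun_prop) fun x hx => (hD0 x hx).trans_le (hDφ k x).1
  have hbi : Integrable (fun x => C * ‖w x‖) (volume.restrict Ω) :=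
    ((hw.integrable_of_hasCompactSupport hwc).norm.const_mul C).integrableOn
  have hconv : ∀ᵐ x ∂(volume.restrict Ω),
      Tendsto (fun k => A (φ k x, gradient (φ k) x, x) * w x) atTop
        (𝓝 (A (D x, ν x, x) * w x)) := by
    filter_upwards [hν, ae_restrict_mem hΩ.measurableSet] with x hx hxΩ
    have hAt : ContinuousAt A (D x, ν x, x) :=
      hA.continuousAt ((isOpen_lt continuous_const continuous_fst).mem_nhds (hD0 x hxΩ))
    exact (hAt.tendsto.comp ((hlim x).prodMk_nhds (hx.prodMk_nhds tendsto_const_nhds))).mul_const _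
  refine ⟨fun k => hbi.mono' (hmeas k) (Eventually.of_forall (hbound k)), ?_,
    tendsto_integral_of_dominated_convergence _ hmeas hbi
      (fun k => Eventually.of_forall (hbound k)) hconv⟩
  -- No measurability of `ν` is assumed: the limit integrand inherits it as an almost everywhere
  -- limit.
  refine hbi.mono' (aestronglyMeasurable_of_tendsto_ae atTop hmeas hconv) ?_
  filter_upwards [hconv] with x hx
  exact le_of_tendsto hx.norm (Eventually.of_forall fun k => hbound k x)

end Limit

/-! ### The Hardy inequality for the boundary distance. -/

theorem theorem3p1 {n : ℕ} (G : StratifiedGroup n) {𝕜 : Type*} [RCLike 𝕜]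
    (Ω : Set (RSpace n)) (hΩ_open : IsOpen Ω) (hΩ_convex : Convex ℝ Ω)
    (ν : RSpace n → RSpace n) (hν : IsNearestNormalMap Ω ν)
    (β : ℝ) (hβ : β < 0)
    (u : RSpace n → 𝕜) (hu : ContDiff ℝ ∞ u) (hu_compact : HasCompactSupport u)
    (hu_supp : tsupport u ⊆ Ω) :
    IntegrableOn (fun x => ‖G.horizontalGradient u x‖ ^ 2) Ω ∧
    IntegrableOn (fun x =>
      G.angleFunction (ν x) x ^ 2 / Metric.infDist x (frontier Ω) ^ 2 * ‖u x‖ ^ 2) Ω ∧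
    IntegrableOn (fun x =>
      (∑ i, G.XDeriv i (fun y => inner ℝ (G.X i y) (ν x)) x / Metric.infDist x (frontier Ω))
        * ‖u x‖ ^ 2) Ω ∧
    (∫ x in Ω, ‖G.horizontalGradient u x‖ ^ 2) ≥
      -(β ^ 2 + β) * (∫ x in Ω,
        G.angleFunction (ν x) x ^ 2 / Metric.infDist x (frontier Ω) ^ 2 * ‖u x‖ ^ 2) +
      β * (∫ x in Ω,
        (∑ i, G.XDeriv i (fun y => inner ℝ (G.X i y) (ν x)) x / Metric.infDist x (frontier Ω))
          * ‖u x‖ ^ 2) := by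
  refine ⟨(integrable_norm_sq_horizontalGradient G hu hu_compact).integrableOn, ?_⟩
  rcases Ω.eq_empty_or_nonempty with rfl | hne
  · simp
  obtain ⟨D, hDL, hDc, hDeq, hDsuper⟩ := hν.exists_concave_extension hΩ_open hne
  -- The error is `1 / (k + 1)`: it tends to zero and never exceeds `1`, the uniform bound needed
  -- for domination.
  choose φ hφ hφL hφc hφD using fun k : ℕ =>
    exists_contDiff_concave_approx hDL hDc (Nat.one_div_pos_of_nat (α := ℝ) (n := k))
  have hlim (x : RSpace n) : Tendsto (fun k => φ k x) atTop (𝓝 (D x)) := by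
    refine tendsto_of_tendsto_of_tendsto_of_le_of_le tendsto_const_nhds ?_
      (fun k => (hφD k x).1) fun k => (hφD k x).2
    simpa using (tendsto_one_div_add_atTop_nhds_zero_nat (𝕜 := ℝ)).const_add (D x)
  have hDφ (k : ℕ) (x : RSpace n) : D x ≤ φ k x ∧ φ k x ≤ D x + 1 := by
    refine ⟨(hφD k x).1, (hφD k x).2.trans ?_⟩
    gcongr
    rw [div_le_one (by positivity)]
    simp
  have hD0 (x : RSpace n) (hx : x ∈ Ω) : 0 < D x := by
    rw [hDeq x hx]
    exact hν.infDist_frontier_pos hΩ_open hx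
  have hgrad : ∀ᵐ x ∂(volume.restrict Ω),
      Tendsto (fun k => gradient (φ k) x) atTop (𝓝 (ν x)) := by
    filter_upwards [ae_restrict_of_ae hDL.ae_differentiableAt,
      ae_restrict_mem hΩ_open.measurableSet] with x hdiff hx
    have h := tendsto_gradient_of_concaveOn hφc (fun k => (hφ k).differentiable (by simp)) hlim
      hdiff
    -- Where `D` is differentiable its only supergradient is the derivative, so any choice of
    -- nearest normal agrees with `∇D` there.
    have heq : fderiv ℝ D x = InnerProductSpace.toDual ℝ (RSpace n) (ν x) :=
      fderiv_eq_of_forall_le_add hdiff fun y => by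
        rw [InnerProductSpace.toDual_apply_apply, real_inner_comm]
        exact hDsuper x hx y
    rwa [gradient, heq, LinearIsometryEquiv.symm_apply_apply] at h
  have hw : Continuous fun x => ‖u x‖ ^ 2 := hu.continuous.norm.pow 2
  have hw_supp : tsupport (fun x => ‖u x‖ ^ 2) ⊆ tsupport u :=
    closure_mono fun x hx => by
      contrapose! hx
      rw [Function.notMem_support] at hx ⊢
      simp [hx]
  have hwc : HasCompactSupport fun x => ‖u x‖ ^ 2 :=
    hu_compact.of_isClosed_subset (isClosed_tsupport _) hw_supp
  obtain ⟨h₁, hi₁, ht₁⟩ := tendsto_integral_weight hΩ_open (continuousOn_angleWeight G) hw hwc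
    (hw_supp.trans hu_supp) hDL.continuous hD0 hφ hφL hDφ hlim hgrad
  obtain ⟨h₂, hi₂, ht₂⟩ := tendsto_integral_weight hΩ_open (continuousOn_driftWeight G) hw hwc
    (hw_supp.trans hu_supp) hDL.continuous hD0 hφ hφL hDφ hlim hgrad
  have hangle : EqOn (fun x => angleWeight G (D x, ν x, x) * ‖u x‖ ^ 2)
      (fun x => G.angleFunction (ν x) x ^ 2 / infDist x (frontier Ω) ^ 2 * ‖u x‖ ^ 2) Ω := by
    intro x hx
    simp only [angleWeight, StratifiedGroup.angleFunction, hDeq x hx]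
    rw [Real.sq_sqrt (Finset.sum_nonneg fun i _ => sq_nonneg _)]
  have hdrift : EqOn (fun x => driftWeight G (D x, ν x, x) * ‖u x‖ ^ 2)
      (fun x => (∑ i, G.XDeriv i (fun y => inner ℝ (G.X i y) (ν x)) x /
        infDist x (frontier Ω)) * ‖u x‖ ^ 2) Ω := by
    intro x hx
    have hX (i : G.FirstStratum) : G.XDeriv i (fun y => inner ℝ (G.X i y) (ν x)) x =
        inner ℝ (fderiv ℝ (G.X i) x (G.X i x)) (ν x) := by
      have hd : DifferentiableAt ℝ (G.X i) x := (G.contDiff_X i).differentiable (by simp) x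
      rw [StratifiedGroup.XDeriv, fderiv_inner_apply ℝ hd (differentiableAt_const _)]
      simp
    simp only [driftWeight, hDeq x hx, hX]
  refine ⟨hi₁.congr_fun hangle hΩ_open.measurableSet,
    hi₂.congr_fun hdrift hΩ_open.measurableSet, ?_⟩
  rw [← setIntegral_congr_fun hΩ_open.measurableSet hangle,
    ← setIntegral_congr_fun hΩ_open.measurableSet hdrift]
  refine le_of_tendsto ((ht₁.const_mul _).add (ht₂.const_mul _)) (Eventually.of_forall fun k => ?_)
  exact integral_hardyWeight_le_of_contDiff G hΩ_open hβ hu hu_compact hu_supp (hφ k) (hφc k)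
    (fun x hx => (hD0 x hx).trans_le (hDφ k x).1) (h₁ k) (h₂ k)
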